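/- For $n\ge 1$, let $\mathrm{GRID}_n$ be the multigraph obtained from the $n\times n$ grid graph by adding one extra vertex, the sink, joined by two edges to each corner vertex and by one edge to each other boundary vertex of the grid (for $n=1$ the only vertex is a corner). The vertices other than the sink are called ordinary. A configuration is a map $c$ from the ordinary vertices to $\mathbb{N}=\{0,1,2,\dots\}$. An ordinary vertex $v$ is unstable in $c$ if $c(v)\ge\deg(v)$ (edges to the sink count in the degree); an unstable vertex may topple: it loses $\deg(v)$ particles, and every ordinary neighbour gains one particle for each edge joining it to $v$. A configuration is stable if it has no unstable vertex. A configuration $c_2$ is reachable from $c_1$ if some configuration $c_3\ge c_1$ (pointwise) can be transformed into $c_2$ by a finite, possibly empty, sequence of topplings of unstable vertices; $c$ is recurrent if it is reachable from every configuration, and transient otherwise. Start with the empty configuration $0$ and add particles one at a time at ordinary vertices of one's choice, relaxing to a stable configuration by topplings after each addition. The transience class $\mathrm{tcl}(\mathrm{GRID}_n)$ is the maximum number of particles that can be added in this way such that all the stable configurations obtained, the initial one included, are transient (and it is $0$ if $0$ itself is recurrent). **Theorem.** $\mathrm{tcl}(\mathrm{GRID}_n)=O(n^7)$. That is, there is a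 constant $C$ such that for every $n\ge 1$ the transience class $\mathrm{tcl}(\mathrm{GRID}_n)$ is finite and at most $C\,n^7$. -/

import Mathlib

/-- A sandpile with ordinary vertices `V`: a connected finite loopless multigraph on `Option V`,
whose distinguished vertex `none` is the sink. `mult u v` is the number of edges joining `u`
and `v`. -/
structure Sandpile (V : Type*) where
  mult : Option V → Option V → ℕ
  mult_symm : ∀ u v, mult u v = mult v u
  mult_self : ∀ u, mult u u = 0
  connected : (SimpleGraph.fromRel fun u v => 0 < mult u v).Connected

namespace Sandpile

variable {V : Type*} [Fintype V] (S : Sandpile V)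

/-- The degree of an ordinary vertex, edges to the sink included. -/
def degree (v : V) : ℕ := ∑ u : Option V, S.mult (some v) u

/-- A configuration `c : V → ℕ` is stable if no ordinary vertex holds as many particles as its
degree. -/
def Stable (c : V → ℕ) : Prop := ∀ v, c v < S.degree v

/-- `c'` arises from `c` by toppling the unstable vertex `v` once. -/
def TopplesAt (v : V) (c c' : V → ℕ) : Prop :=
  S.degree v ≤ c v ∧ c' v = c v - S.degree v ∧
    ∀ u, u ≠ v → c' u = c u + S.mult (some v) (some u)

/-- There is a (possibly empty) toppling sequence from `c` to `c'`. -/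
def TopplesTo : (V → ℕ) → (V → ℕ) → Prop :=
  Relation.ReflTransGen fun c c' => ∃ v, S.TopplesAt v c c'

/-- `c₂` is reachable from `c₁`: some `c₃ ≥ c₁` has a toppling sequence to `c₂`. -/
def Reachable (c₁ c₂ : V → ℕ) : Prop := ∃ c₃, c₁ ≤ c₃ ∧ S.TopplesTo c₃ c₂

/-- A configuration is recurrent if it is reachable from every configuration. -/
def Recurrent (c : V → ℕ) : Prop := ∀ c', S.Reachable c' c

/-- A configuration is transient if it is not recurrent. -/
def Transient (c : V → ℕ) : Prop := ¬ S.Recurrent c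

/-- `S.TransientRun t c`: starting with the empty configuration, one can add `t` particles, one at
a time at vertices of one's choice and relaxing to a stable configuration after each addition, so
that every configuration obtained (the initial and the final one included) is transient and the
final one is `c`. -/
inductive TransientRun [DecidableEq V] : ℕ → (V → ℕ) → Prop
  | empty : S.Transient 0 → TransientRun 0 0
  | add {t : ℕ} {c c' : V → ℕ} (v : V) : TransientRun t c →
      S.TopplesTo (c + Pi.single v 1) c' → S.Stable c' → S.Transient c' →
      TransientRun (t + 1) c'

/-- The transience class: the maximum number of particles that can be added to the empty sandpile
before reaching a recurrent configuration. It takes values in `ℕ∞`, hence is `⊤` if the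
number is unbounded. -/
noncomputable def tcl [DecidableEq V] : ℕ∞ := ⨆ (t : ℕ) (_ : ∃ c, S.TransientRun t c), (t : ℕ∞)

end Sandpile

/-- The `n × n` grid graph. -/
abbrev gridGraph (n : ℕ) : SimpleGraph (Fin n × Fin n) :=
  SimpleGraph.boxProd (SimpleGraph.pathGraph n) (SimpleGraph.pathGraph n)

/-- `i` is the first or the last index. -/
abbrev GridExtreme {n : ℕ} (i : Fin n) : Prop := (i : ℕ) = 0 ∨ (i : ℕ) + 1 = n

/-- The number of edges to the sink: two from a corner, one from any other boundary vertex. -/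
def gridSinkEdges {n : ℕ} (p : Fin n × Fin n) : ℕ :=
  if GridExtreme p.1 ∧ GridExtreme p.2 then 2
  else if GridExtreme p.1 ∨ GridExtreme p.2 then 1 else 0

open Classical in
/-- Edge multiplicities of the grid with a sink attached to its boundary. -/
noncomputable def gridMult (n : ℕ) : Option (Fin n × Fin n) → Option (Fin n × Fin n) → ℕ
  | some p, some q => if (gridGraph n).Adj p q then 1 else 0
  | some p, none => gridSinkEdges p
  | none, some p => gridSinkEdges p
  | none, none => 0

theorem gridMult_connected (n : ℕ) :
    (SimpleGraph.fromRel fun u v => 0 < gridMult n u v).Connected := by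
  rw [SimpleGraph.connected_iff_exists_forall_reachable]
  refine ⟨none, ?_⟩
  rintro (_ | ⟨i, j⟩)
  · exact SimpleGraph.Reachable.refl _
  · obtain ⟨m, rfl⟩ : ∃ m, n = m + 1 := ⟨n - 1, by have := i.2; omega⟩
    have hG : (gridGraph (m + 1)).Connected :=
      (SimpleGraph.pathGraph_connected m).boxProd (SimpleGraph.pathGraph_connected m)
    let f : gridGraph (m + 1) →g
        (SimpleGraph.fromRel fun u v => 0 < gridMult (m + 1) u v) :=
      { toFun := some
        map_rel' := by
          intro p q h
          rw [SimpleGraph.fromRel_adj]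
          refine ⟨fun e => h.ne (Option.some.inj e), Or.inl ?_⟩
          simp only [gridMult, if_pos h, Nat.one_pos] }
    have h1 := (hG.preconnected (0, 0) (i, j)).map f
    refine SimpleGraph.Reachable.trans (SimpleGraph.Adj.reachable ?_) h1
    rw [SimpleGraph.fromRel_adj]
    refine ⟨by simp [f], Or.inl ?_⟩
    change 0 < gridSinkEdges ((0, 0) : Fin (m + 1) × Fin (m + 1))
    simp [gridSinkEdges, GridExtreme]

/-- The sandpile `GRID_n`. -/
noncomputable def gridSandpile (n : ℕ) : Sandpile (Fin n × Fin n) where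
  mult := gridMult n
  mult_symm := by
    rintro (_ | p) (_ | q) <;> simp only [gridMult]
    by_cases h : (gridGraph n).Adj p q
    · rw [if_pos h, if_pos h.symm]
    · rw [if_neg h, if_neg fun h' => h h'.symm]
  mult_self := by
    rintro (_ | p) <;> simp [gridMult]
  connected := gridMult_connected n

/-! Follow the odometer `z`, the number of topplings at each vertex. If every vertex has toppled,
the current configuration is recurrent: every nonempty set `F` contains a vertex holding at least
its number of edges into `F` (`IsOdometer.ample`), and this suffices for recurrence
(`recurrent_of_ample`). So a transient run leaves some vertex `v` untoppled.

Let `g ≥ ε > 0` be subharmonic off `v`. Toppling anywhere but `v` does not decrease the `g`-weighted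
number of particles, so `t` additions give `t ε ≤ ∑ deg · g` (`TransientRun.mul_le`).

On the grid, `g` is the Green function at `v` of the lazy walk killed at the sink, truncated at a
time of order `n²`. Its total mass is `O(n²)`. By the explicit sine spectrum, each `P^m(v, p)` with
`m` between `4(n+1)²` and `5(n+1)²` is at least a constant times `n⁻⁶`, so `g` is at least of order
`n⁻⁴`. The quotient is `O(n⁶)`, which is stronger than the claim. -/

namespace Sandpile

variable {V : Type*} [Fintype V] (S : Sandpile V)

/-! ### Firing scripts and a criterion for recurrence. -/

theorem sum_mult_le_degree (u : V) : ∑ w, S.mult (some w) (some u) ≤ S.degree u := by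
  rw [degree, Fintype.sum_option]
  simp_rw [S.mult_symm (some u)]
  omega

theorem sum_mult_add_single [DecidableEq V] (w : V → ℕ) (u v : V) :
    ∑ y, S.mult (some y) (some u) * (w + (Pi.single v 1 : V → ℕ)) y =
      ∑ y, S.mult (some y) (some u) * w y + S.mult (some v) (some u) := by
  simp [mul_add, Finset.sum_add_distrib, Pi.single_apply]

/-- Legality of a firing script: if every nonempty set of vertices contains a vertex holding at
least as many particles as it has edges into the set, then any script `w` can be fired from
`c + Δ w`, ending in `c`. -/
theorem topplesTo_of_script [DecidableEq V] {c : V → ℕ}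
    (hc : ∀ F : Finset V, F.Nonempty → ∃ u ∈ F, ∑ w ∈ F, S.mult (some w) (some u) ≤ c u) (k : ℕ) :
    ∀ w d : V → ℕ, ∑ u, w u = k →
      (∀ u, d u + ∑ y, S.mult (some y) (some u) * w y = c u + S.degree u * w u) →
      S.TopplesTo d c := by
  induction k with
  | zero =>
    intro w d hw hd
    have hw0 : ∀ u, w u = 0 := by simpa using hw
    have : d = c := by
      funext u
      simpa [hw0] using hd u
    rw [this]
    exact Relation.ReflTransGen.refl
  | succ k ih =>
    intro w d hw hd
    obtain ⟨u₀, hu₀⟩ : ∃ u₀, 0 < w u₀ := by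
      by_contra! h
      have h0 : ∑ u, w u = 0 := Finset.sum_eq_zero fun u _ => Nat.le_zero.mp (h u)
      omega
    obtain ⟨a, -, ha⟩ := Finset.exists_max_image Finset.univ w ⟨u₀, Finset.mem_univ _⟩
    have ha0 : 0 < w a := hu₀.trans_le (ha u₀ (Finset.mem_univ _))
    obtain ⟨r, hr⟩ : ∃ r, w a = r + 1 := ⟨w a - 1, by omega⟩
    -- Vertices outside this set fire at most `r` times, so `v` receives at most `deg v * r + c v`
    -- particles in all; the balance equation then leaves `v` unstable in `d`.
    obtain ⟨v, hvF, hv⟩ := hc (Finset.univ.filter fun u => w u = w a) ⟨a, by simp⟩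
    have hvw : w v = r + 1 := by simpa [hr] using hvF
    have hlegal : S.degree v ≤ d v := by
      have h1 : ∑ y, S.mult (some y) (some v) * w y ≤ S.degree v * r + c v := by
        calc ∑ y, S.mult (some y) (some v) * w y
            ≤ ∑ y, (S.mult (some y) (some v) * r +
                if w y = w a then S.mult (some y) (some v) else 0) := by
              refine Finset.sum_le_sum fun y _ => ?_
              have := ha y (Finset.mem_univ _)
              split_ifs with h
              · rw [h, hr, mul_add, mul_one]
              · exact Nat.mul_le_mul le_rfl (by omega)
          _ = (∑ y, S.mult (some y) (some v)) * r +
                ∑ y ∈ Finset.univ.filter (fun u => w u = w a), S.mult (some y) (some v) := by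
              rw [Finset.sum_add_distrib, Finset.sum_mul, Finset.sum_filter]
          _ ≤ S.degree v * r + c v :=
              add_le_add (Nat.mul_le_mul (S.sum_mult_le_degree v) le_rfl) hv
      have h2 := hd v
      rw [hvw, mul_add, mul_one] at h2
      omega
    obtain ⟨w', rfl⟩ : ∃ w' : V → ℕ, w = w' + (Pi.single v 1 : V → ℕ) := by
      refine ⟨w - (Pi.single v 1 : V → ℕ), ?_⟩
      funext u
      by_cases h : u = v
      · have : 1 ≤ w v := by omega
        simp [h, Nat.sub_add_cancel this]
      · simp [h]
    simp only [sum_mult_add_single] at hd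
    let d' : V → ℕ := fun u => if u = v then d v - S.degree v else d u + S.mult (some v) (some u)
    have hstep : S.TopplesAt v d d' := by
      refine ⟨hlegal, by simp [d'], fun u hu => by simp [d', hu]⟩
    refine Relation.ReflTransGen.head ⟨v, hstep⟩ (ih w' d' ?_ ?_)
    · simpa [Finset.sum_add_distrib] using hw
    · intro u
      have h := hd u
      by_cases huv : u = v
      · subst huv
        simp only [Pi.add_apply, Pi.single_eq_same, S.mult_self, mul_add, mul_one] at h
        simp only [d', if_true]
        omega
      · simp only [Pi.add_apply, Pi.single_eq_of_ne huv, add_zero] at h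
        simp only [d', huv, if_false]
        omega

/-- The script `K E` with `K = ∑ c'` raises `c` by at least `K` at every vertex, hence above `c'`,
and the raised configuration topples back to `c`. -/
theorem recurrent_of_ample [DecidableEq V] {c : V → ℕ}
    (hc : ∀ F : Finset V, F.Nonempty → ∃ u ∈ F, ∑ w ∈ F, S.mult (some w) (some u) ≤ c u)
    {E : V → ℕ} (hE : ∀ u, ∑ y, S.mult (some y) (some u) * E y + 1 ≤ S.degree u * E u) :
    S.Recurrent c := by
  intro c'
  let K := ∑ u, c' u
  have hK : ∀ u, ∑ y, S.mult (some y) (some u) * (K * E y) + K ≤ S.degree u * (K * E u) := by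
    intro u
    have := Nat.mul_le_mul (le_refl K) (hE u)
    calc _ = K * (∑ y, S.mult (some y) (some u) * E y + 1) := by
          rw [mul_add, Finset.mul_sum, mul_one]
          congr 1
          exact Finset.sum_congr rfl fun y _ => by ring
      _ ≤ _ := this
      _ = _ := by ring
  refine ⟨fun u => c u + S.degree u * (K * E u) - ∑ y, S.mult (some y) (some u) * (K * E y),
    fun u => ?_, S.topplesTo_of_script hc _ (fun u => K * E u) _ rfl fun u => ?_⟩
  · have h1 := hK u
    have h2 : c' u ≤ K := Finset.single_le_sum (f := c') (fun _ _ => Nat.zero_le _) (Finset.mem_univ u)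
    simp only
    omega
  · have h1 := hK u
    omega

/-! ### Odometers of runs. -/

/-- `z` counts the topplings at each vertex in some history of `t` additions of particles to the
empty configuration and of topplings which ends in `c`. -/
structure IsOdometer (t : ℕ) (z c : V → ℕ) : Prop where
  balance : ∃ x : V → ℕ, ∑ u, x u = t ∧
    ∀ u, c u + S.degree u * z u = x u + ∑ y, S.mult (some y) (some u) * z y
  ample : ∀ F : Finset V, F.Nonempty → (∀ u ∈ F, 0 < z u) →
    ∃ u ∈ F, ∑ w ∈ F, S.mult (some w) (some u) ≤ c u

variable {S}

/-- The witness for `F` is the vertex whose last toppling is earliest: since then every other vertex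
of `F` has sent it a particle along each common edge. Inductively, the newly toppled `v` is removed
from `F`, and the particles it sends pay for putting it back. -/
theorem IsOdometer.topple [DecidableEq V] {t : ℕ} {z c c' : V → ℕ} {v : V}
    (h : S.IsOdometer t z c) (hv : S.TopplesAt v c c') :
    S.IsOdometer t (z + Pi.single v 1) c' := by
  obtain ⟨⟨x, hx, hb⟩, ha⟩ := h
  obtain ⟨h1, h2, h3⟩ := hv
  refine ⟨⟨x, hx, fun u => ?_⟩, fun F hF hz => ?_⟩
  · have := hb u
    rw [sum_mult_add_single]
    by_cases huv : u = v
    · subst huv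
      simp only [Pi.add_apply, Pi.single_eq_same, S.mult_self, mul_add, mul_one]
      omega
    · simp only [Pi.add_apply, Pi.single_eq_of_ne huv, add_zero, h3 u huv]
      omega
  · by_cases hvF : v ∈ F
    · rcases (F.erase v).eq_empty_or_nonempty with he | hne
      · have hFv : F = {v} := by
          rw [← Finset.insert_erase hvF, he]; rfl
        exact ⟨v, hvF, by simp [hFv, S.mult_self]⟩
      · obtain ⟨u, huF, hu⟩ := ha (F.erase v) hne fun u hu => by
          have := hz u (Finset.mem_of_mem_erase hu)
          simpa [Pi.single_eq_of_ne (Finset.ne_of_mem_erase hu)] using this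
        refine ⟨u, Finset.mem_of_mem_erase huF, ?_⟩
        rw [h3 u (Finset.ne_of_mem_erase huF), ← Finset.sum_erase_add F _ hvF]
        omega
    · have hne : ∀ u ∈ F, u ≠ v := fun u hu e => hvF (e ▸ hu)
      obtain ⟨u, huF, hu⟩ := ha F hF fun u hu => by
        simpa [Pi.single_eq_of_ne (hne u hu)] using hz u hu
      exact ⟨u, huF, hu.trans (by rw [h3 u (hne u huF)]; omega)⟩

theorem IsOdometer.exists_of_topplesTo [DecidableEq V] {t : ℕ} {z c c' : V → ℕ}
    (h : S.IsOdometer t z c) (hc : S.TopplesTo c c') : ∃ z', S.IsOdometer t z' c' := by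
  induction hc with
  | refl => exact ⟨z, h⟩
  | tail _ hs ih =>
    obtain ⟨z', hz'⟩ := ih
    obtain ⟨v, hv⟩ := hs
    exact ⟨_, hz'.topple hv⟩

theorem IsOdometer.add_single [DecidableEq V] {t : ℕ} {z c : V → ℕ}
    (h : S.IsOdometer t z c) (v : V) : S.IsOdometer (t + 1) z (c + Pi.single v 1) := by
  obtain ⟨⟨x, hx, hb⟩, ha⟩ := h
  refine ⟨⟨x + Pi.single v 1, by simp [Finset.sum_add_distrib, hx], fun u => ?_⟩,
    fun F hF hz => ?_⟩
  · have := hb u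
    simp only [Pi.add_apply]
    omega
  · obtain ⟨u, huF, hu⟩ := ha F hF hz
    exact ⟨u, huF, hu.trans (by simp)⟩

theorem TransientRun.exists_isOdometer [DecidableEq V] {t : ℕ} {c : V → ℕ}
    (h : S.TransientRun t c) : ∃ z, S.IsOdometer t z c := by
  induction h with
  | empty _ =>
    refine ⟨0, ⟨0, by simp, by simp⟩, fun F ⟨u, hu⟩ hz => ?_⟩
    exact absurd (hz u hu) (by simp)
  | add v _ hc _ _ ih =>
    obtain ⟨z, hz⟩ := ih
    exact (hz.add_single v).exists_of_topplesTo hc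

theorem TransientRun.transient [DecidableEq V] {t : ℕ} {c : V → ℕ} (h : S.TransientRun t c) :
    S.Transient c := by
  cases h with
  | empty h => exact h
  | add _ _ _ _ h => exact h

theorem TransientRun.le_degree [DecidableEq V] {t : ℕ} {c : V → ℕ} (h : S.TransientRun t c)
    (u : V) : c u ≤ S.degree u := by
  cases h with
  | empty h => exact Nat.zero_le _
  | add _ _ _ h _ => exact (h u).le

/-! ### Bounding a run through a subharmonic weight. -/

/-- If for each vertex `v` there is a function with values at least `ε > 0` which is subharmonic
off `v` and whose degree-weighted sum is at most `B`, then a transient run adds at most `B / ε`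
particles. -/
theorem TransientRun.mul_le [DecidableEq V] {t : ℕ} {c : V → ℕ} (h : S.TransientRun t c)
    {E : V → ℕ} (hE : ∀ u, ∑ y, S.mult (some y) (some u) * E y + 1 ≤ S.degree u * E u)
    {ε B : ℝ} {g : V → V → ℝ} (hε : 0 ≤ ε) (hg : ∀ v u, ε ≤ g v u)
    (hsub : ∀ v u, u ≠ v → S.degree u * g v u ≤ ∑ y, S.mult (some u) (some y) * g v y)
    (hB : ∀ v, ∑ u, S.degree u * g v u ≤ B) : t * ε ≤ B := by
  obtain ⟨z, ⟨x, hx, hb⟩, ha⟩ := h.exists_isOdometer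
  obtain ⟨v, hv⟩ : ∃ v, z v = 0 := by
    by_contra! hz
    exact h.transient (S.recurrent_of_ample
      (fun F hF => ha F hF fun u _ => Nat.pos_of_ne_zero (hz u)) hE)
  have hb' : ∀ u, (x u : ℝ) = c u + S.degree u * z u -
      ∑ y, (S.mult (some y) (some u) : ℝ) * z y := by
    intro u
    have := congrArg (Nat.cast : ℕ → ℝ) (hb u)
    push_cast at this
    linarith
  -- Summation by parts moves the Laplacian from `z` to `g v`.
  have hswap : ∑ u, g v u * ∑ y, (S.mult (some y) (some u) : ℝ) * z y =
      ∑ u, z u * ∑ y, (S.mult (some u) (some y) : ℝ) * g v y := by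
    simp_rw [Finset.mul_sum]
    rw [Finset.sum_comm]
    exact Finset.sum_congr rfl fun _ _ => Finset.sum_congr rfl fun _ _ => by ring
  have hgx : ∑ u, g v u * x u ≤ ∑ u, g v u * c u := by
    have : ∑ u, g v u * x u = ∑ u, g v u * c u +
        ∑ u, z u * (S.degree u * g v u - ∑ y, (S.mult (some u) (some y) : ℝ) * g v y) := by
      simp_rw [hb', mul_sub, Finset.sum_sub_distrib, hswap, mul_add, Finset.sum_add_distrib]
      rw [add_sub_assoc]
      congr 2
      exact Finset.sum_congr rfl fun _ _ => by ring
    rw [this, add_le_iff_nonpos_right]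
    refine Finset.sum_nonpos fun u _ => ?_
    by_cases huv : u = v
    · simp [huv, hv]
    · exact mul_nonpos_of_nonneg_of_nonpos (Nat.cast_nonneg _) (sub_nonpos.mpr (hsub v u huv))
  calc (t : ℝ) * ε = ∑ u, ε * x u := by
        rw [← Finset.mul_sum, ← hx, mul_comm]; push_cast; rfl
    _ ≤ ∑ u, g v u * x u :=
        Finset.sum_le_sum fun u _ => mul_le_mul_of_nonneg_right (hg v u) (Nat.cast_nonneg _)
    _ ≤ ∑ u, g v u * c u := hgx
    _ ≤ ∑ u, S.degree u * g v u := by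
        refine Finset.sum_le_sum fun u _ => ?_
        rw [mul_comm]
        exact mul_le_mul_of_nonneg_right (by exact_mod_cast h.le_degree u) (hε.trans (hg v u))
    _ ≤ B := hB v

end Sandpile

/-! ### Neighbour sums and degrees in the grid. -/

open Classical in
theorem sum_pathGraph_adj {R : Type*} [AddCommMonoid R] {n : ℕ} (i : Fin n) {f : ℕ → R}
    (h0 : f 0 = 0) (hn : f (n + 1) = 0) :
    ∑ k : Fin n, (if (SimpleGraph.pathGraph n).Adj i k then f (k + 1) else 0) =
      f i + f (i + 2) := by
  have hsplit : ∀ k : Fin n, (if (SimpleGraph.pathGraph n).Adj i k then f (k + 1) else 0) =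
      (if (k : ℕ) + 1 = i then f i else 0) + if (i : ℕ) + 1 = k then f (i + 2) else 0 := by
    intro k
    simp only [SimpleGraph.pathGraph_adj]
    by_cases h1 : (k : ℕ) + 1 = i
    · have h2 : ¬ (i : ℕ) + 1 = k := by omega
      simp [h1, h2]
    · by_cases h2 : (i : ℕ) + 1 = k
      · rw [if_pos (Or.inl h2), if_neg h1, if_pos h2, zero_add, ← h2]
      · simp [h1, h2]
  rw [Finset.sum_congr rfl fun k _ => hsplit k, Finset.sum_add_distrib]
  congr 1
  · rcases Nat.eq_zero_or_pos (i : ℕ) with hi | hi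
    · simp [hi, h0]
    · rw [Finset.sum_eq_single (⟨i - 1, by omega⟩ : Fin n)]
      · rw [if_pos (by simp only; omega)]
      · intro k _ hk
        rw [if_neg]
        intro h
        exact hk (Fin.ext (by simp only; omega))
      · simp
  · by_cases hi : (i : ℕ) + 1 < n
    · rw [Finset.sum_eq_single (⟨i + 1, hi⟩ : Fin n)]
      · simp
      · intro k _ hk
        rw [if_neg]
        intro h
        exact hk (Fin.ext h.symm)
      · simp
    · have : (i : ℕ) + 2 = n + 1 := by omega
      simp [this, hn]

/-- Sums over the neighbours of a grid vertex, for functions on `{0, …, n + 1}²` that vanish on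
the outer frame; the grid vertex `(i, j)` has coordinates `(i + 1, j + 1)`. -/
theorem sum_gridMult {R : Type*} [Semiring R] {n : ℕ} (p : Fin n × Fin n) {F : ℕ → ℕ → R}
    (h1 : ∀ b, F 0 b = 0) (h2 : ∀ b, F (n + 1) b = 0) (h3 : ∀ a, F a 0 = 0)
    (h4 : ∀ a, F a (n + 1) = 0) :
    ∑ q : Fin n × Fin n, ((gridSandpile n).mult (some p) (some q) : R) * F (q.1 + 1) (q.2 + 1) =
      F p.1 (p.2 + 1) + F (p.1 + 2) (p.2 + 1) + (F (p.1 + 1) p.2 + F (p.1 + 1) (p.2 + 2)) := by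
  classical
  obtain ⟨i, j⟩ := p
  have hsplit : ∀ q : Fin n × Fin n,
      ((gridSandpile n).mult (some (i, j)) (some q) : R) * F (q.1 + 1) (q.2 + 1) =
      (if j = q.2 then (if (SimpleGraph.pathGraph n).Adj i q.1 then F (q.1 + 1) (j + 1) else 0)
        else 0) +
      if i = q.1 then (if (SimpleGraph.pathGraph n).Adj j q.2 then F (i + 1) (q.2 + 1) else 0)
        else 0 := by
    rintro ⟨k, l⟩
    simp only [gridSandpile, gridMult, SimpleGraph.boxProd_adj]
    by_cases hj : j = l
    · subst hj
      by_cases hi : i = k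
      · subst hi; simp
      · simp [hi]
    · by_cases hi : i = k
      · subst hi; simp [hj]
      · simp [hi, hj]
  rw [Finset.sum_congr rfl fun q _ => hsplit q, Finset.sum_add_distrib]
  congr 1
  · rw [Fintype.sum_prod_type]
    simp only [Finset.sum_ite_eq, Finset.mem_univ, if_true]
    exact sum_pathGraph_adj i (f := fun a => F a (j + 1)) (h1 _) (h2 _)
  · rw [Fintype.sum_prod_type_right]
    simp only [Finset.sum_ite_eq, Finset.mem_univ, if_true]
    exact sum_pathGraph_adj j (f := fun b => F (i + 1) b) (h3 _) (h4 _)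

/-- Each extreme coordinate trades a missing neighbour for a sink edge. For `n = 1` a coordinate is
extreme at both ends but counted once, and the degree is 2. -/
theorem gridSandpile_degree {n : ℕ} (hn : 2 ≤ n) (p : Fin n × Fin n) :
    (gridSandpile n).degree p = 4 := by
  let χ : ℕ → ℕ := fun a => if a = 0 ∨ a = n + 1 then 0 else 1
  have hχ : ∀ i : Fin n, χ (i + 1) = 1 := fun i => if_neg (by omega)
  have hadj : ∀ i : Fin n, χ i + χ (i + 2) + (if GridExtreme i then 1 else 0) = 2 := by
    rintro ⟨i, hi⟩
    simp only [χ, GridExtreme]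
    split_ifs <;> simp only [false_or] at * <;> omega
  have hsink : gridSinkEdges p =
      (if GridExtreme p.1 then 1 else 0) + if GridExtreme p.2 then 1 else 0 := by
    simp only [gridSinkEdges]
    by_cases h1 : GridExtreme p.1 <;> by_cases h2 : GridExtreme p.2 <;> simp [h1, h2]
  have h := sum_gridMult p (F := fun a b => χ a * χ b)
    (by simp [χ]) (by simp [χ]) (by simp [χ]) (by simp [χ])
  simp only [hχ, mul_one, one_mul, Nat.cast_id] at h
  rw [Sandpile.degree, Fintype.sum_option, h]
  change gridSinkEdges p + _ = 4
  have := hadj p.1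
  have := hadj p.2
  omega

theorem gridSandpile_exists_superharmonic {n : ℕ} (hn : 2 ≤ n) : ∃ E : Fin n × Fin n → ℕ,
    ∀ u, ∑ y, (gridSandpile n).mult (some y) (some u) * E y + 1 ≤
      (gridSandpile n).degree u * E u := by
  -- A concave parabola in one coordinate, with second difference `-2`; the cut to zero on the other
  -- two sides only lowers the neighbour sums.
  let F : ℕ → ℕ → ℕ := fun a b => if b = 0 ∨ b = n + 1 then 0 else a * (n + 1 - a)
  refine ⟨fun q => F (q.1 + 1) (q.2 + 1), fun u => ?_⟩
  have h := sum_gridMult u (F := F) (by simp [F]) (by simp [F]) (by simp [F]) (by simp [F])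
  simp only [Nat.cast_id] at h
  simp_rw [(gridSandpile n).mult_symm _ (some u)]
  rw [h, gridSandpile_degree hn]
  obtain ⟨⟨i, hi⟩, ⟨j, hj⟩⟩ := u
  simp only
  obtain ⟨m, rfl⟩ : ∃ m, n = i + 1 + m := ⟨n - (i + 1), by omega⟩
  have e1 : i + 1 + m + 1 - i = m + 2 := by omega
  have e2 : i + 1 + m + 1 - (i + 2) = m := by omega
  have e3 : i + 1 + m + 1 - (i + 1) = m + 1 := by omega
  have hle : ∀ b, F (i + 1) b ≤ (i + 1) * (m + 1) := by
    intro b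
    simp only [F, e3]
    split_ifs <;> simp
  have hj' : ¬ (j + 1 = 0 ∨ j + 1 = i + 1 + m + 1) := by omega
  have f1 : F i (j + 1) = i * (m + 2) := by simp only [F, if_neg hj', e1]
  have f2 : F (i + 2) (j + 1) = (i + 2) * m := by simp only [F, if_neg hj', e2]
  have f3 : F (i + 1) (j + 1) = (i + 1) * (m + 1) := by simp only [F, if_neg hj', e3]
  rw [f1, f2, f3]
  have := hle j
  have := hle (j + 2)
  nlinarith

/-! ### Trigonometric sums and estimates. -/

theorem Real.abs_sin_nat_mul_le_mul (k : ℕ) (x : ℝ) : |Real.sin (k * x)| ≤ k * |Real.sin x| := by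
  induction k with
  | zero => simp
  | succ k ih =>
    push_cast
    rw [add_mul, one_mul, Real.sin_add]
    calc _ ≤ |Real.sin (k * x) * Real.cos x| + |Real.cos (k * x) * Real.sin x| := abs_add_le _ _
      _ ≤ |Real.sin (k * x)| * 1 + 1 * |Real.sin x| := by
        rw [abs_mul, abs_mul]
        gcongr <;> exact Real.abs_cos_le_one _
      _ ≤ _ := by linarith

theorem two_mul_sin_half_mul_sum_cos (n : ℕ) (α : ℝ) :
    2 * Real.sin (α / 2) * ∑ k ∈ Finset.range n, Real.cos ((k + 1) * α) =
      Real.sin ((n + 1) * α - α / 2) - Real.sin (α / 2) := by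
  induction n with
  | zero => simp; ring_nf
  | succ n ih =>
    rw [Finset.sum_range_succ, mul_add, ih, Real.two_mul_sin_mul_cos]
    have h1 : α / 2 - (n + 1) * α = -((n + 1) * α - α / 2) := by ring
    have h2 : α / 2 + (n + 1) * α = ((n + 1 : ℕ) + 1) * α - α / 2 := by push_cast; ring
    rw [h1, h2, Real.sin_neg]
    ring

theorem sum_cos_eq {n : ℕ} {α : ℝ} (h1 : Real.sin ((n + 1) * α) = 0)
    (h2 : Real.sin (α / 2) ≠ 0) :
    ∑ k ∈ Finset.range n, Real.cos ((k + 1) * α) = -(1 + Real.cos ((n + 1) * α)) / 2 := by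
  have h := two_mul_sin_half_mul_sum_cos n α
  rw [Real.sin_sub, h1] at h
  have : Real.sin (α / 2) * (2 * ∑ k ∈ Finset.range n, Real.cos ((k + 1) * α) +
      (1 + Real.cos ((n + 1) * α))) = 0 := by linarith
  have := (mul_eq_zero.mp this).resolve_left h2
  linarith

/-- Orthogonality of the discrete sine functions. -/
theorem sum_sin_mul_sin {n : ℕ} (a b : Fin n) :
    ∑ k ∈ Finset.range n, Real.sin ((k + 1 : ℕ) * ((a + 1 : ℕ) * (Real.pi / (n + 1)))) *
      Real.sin ((k + 1 : ℕ) * ((b + 1 : ℕ) * (Real.pi / (n + 1)))) =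
      if b = a then ((n : ℝ) + 1) / 2 else 0 := by
  set θ : ℝ := Real.pi / (n + 1) with hθ
  have hn : (0 : ℝ) < n + 1 := by positivity
  have hθN : (n + 1) * θ = Real.pi := by rw [hθ]; field_simp
  have hθ0 : 0 < θ := div_pos Real.pi_pos hn
  set A : ℝ := ((a + 1 : ℕ) : ℝ) with hA
  set B : ℝ := ((b + 1 : ℕ) : ℝ) with hB
  have hA1 : 1 ≤ A := by rw [hA]; exact_mod_cast (by omega : 1 ≤ (a : ℕ) + 1)
  have hB1 : 1 ≤ B := by rw [hB]; exact_mod_cast (by omega : 1 ≤ (b : ℕ) + 1)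
  have hAn : A + 1 ≤ n + 1 := by rw [hA]; exact_mod_cast (by omega : (a : ℕ) + 1 + 1 ≤ n + 1)
  have hBn : B + 1 ≤ n + 1 := by rw [hB]; exact_mod_cast (by omega : (b : ℕ) + 1 + 1 ≤ n + 1)
  have hterm : ∀ k : ℕ, Real.sin ((k + 1 : ℕ) * (A * θ)) * Real.sin ((k + 1 : ℕ) * (B * θ)) =
      (Real.cos ((k + 1) * ((A - B) * θ)) - Real.cos ((k + 1) * ((A + B) * θ))) / 2 := by
    intro k
    have := Real.two_mul_sin_mul_sin ((k + 1 : ℕ) * (A * θ)) ((k + 1 : ℕ) * (B * θ))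
    have e1 : ((k + 1 : ℕ) : ℝ) * (A * θ) - (k + 1 : ℕ) * (B * θ) = (k + 1) * ((A - B) * θ) := by
      push_cast; ring
    have e2 : ((k + 1 : ℕ) : ℝ) * (A * θ) + (k + 1 : ℕ) * (B * θ) = (k + 1) * ((A + B) * θ) := by
      push_cast; ring
    rw [e1, e2] at this
    linarith
  have hplus : (n + 1) * ((A + B) * θ) = (A + B) * Real.pi := by rw [← hθN]; ring
  have hminus : (n + 1) * ((A - B) * θ) = (A - B) * Real.pi := by rw [← hθN]; ring
  have hAπ : Real.sin (A * Real.pi) = 0 := Real.sin_nat_mul_pi _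
  have hBπ : Real.sin (B * Real.pi) = 0 := Real.sin_nat_mul_pi _
  have hsumplus : ∑ k ∈ Finset.range n, Real.cos ((k + 1) * ((A + B) * θ)) =
      -(1 + Real.cos ((A + B) * Real.pi)) / 2 := by
    rw [sum_cos_eq, hplus]
    · rw [hplus, add_mul, Real.sin_add, hAπ, hBπ]; ring
    · refine (Real.sin_pos_of_pos_of_lt_pi (by positivity) ?_).ne'
      nlinarith
  simp_rw [hterm]
  rw [← Finset.sum_div, Finset.sum_sub_distrib, hsumplus]
  split_ifs with hab
  · have hBA : B = A := by rw [hA, hB, hab]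
    have : (A + A) * Real.pi = (a + 1 : ℕ) * (2 * Real.pi) := by rw [hA]; ring
    rw [hBA, this, Real.cos_nat_mul_two_pi]
    simp
  · have hne : A - B ≠ 0 := by
      rw [sub_ne_zero, hA, hB]
      intro h
      have : (a : ℕ) + 1 = b + 1 := by exact_mod_cast h
      exact hab (Fin.ext (by omega))
    -- `A - B` and `A + B` have the same parity, so the two cosine sums cancel.
    have hcos : Real.cos ((A - B) * Real.pi) = Real.cos ((A + B) * Real.pi) := by
      have : (A + B) * Real.pi = (A - B) * Real.pi + (b + 1 : ℕ) * (2 * Real.pi) := by rw [hB]; ring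
      rw [this, Real.cos_add_nat_mul_two_pi]
    rw [sum_cos_eq, hminus, hcos]
    · ring
    · rw [hminus, sub_mul, Real.sin_sub, hAπ, hBπ]; ring
    · intro h
      rw [Real.sin_eq_zero_iff_of_lt_of_lt (by nlinarith) (by nlinarith)] at h
      exact hne (by nlinarith [mul_eq_zero.mp (by linarith : (A - B) * θ = 0)])

/-- The difference is a product of two sines, each bounded below by Jordan's inequality `sin x ≥
2x/π`; the factors `k` and `k + 2` multiply to `(k + 1)² - 1`. -/
theorem cos_sub_cos_nat_mul_ge {n k : ℕ} (hk : k < n) :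
    2 * (((k + 1 : ℕ) : ℝ) ^ 2 - 1) / (n + 1) ^ 2 ≤
      Real.cos (Real.pi / (n + 1)) - Real.cos ((k + 1 : ℕ) * (Real.pi / (n + 1))) := by
  have hn : (0 : ℝ) < n + 1 := by positivity
  have hkn : (k : ℝ) + 1 ≤ n := by exact_mod_cast hk
  set θ : ℝ := Real.pi / (n + 1) with hθ
  have hbound : ∀ s : ℝ, 0 ≤ s → s ≤ n + 1 → s / (n + 1) ≤ Real.sin (s * θ / 2) := by
    intro s hs hsn
    have hle : s * θ / 2 ≤ Real.pi / 2 := by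
      rw [hθ, ← mul_div_assoc, div_le_div_iff_of_pos_right two_pos, div_le_iff₀ hn]
      nlinarith [Real.pi_pos]
    refine le_trans (le_of_eq ?_) (Real.mul_le_sin (by positivity) hle)
    rw [hθ]
    field_simp
  have h1 := hbound (k + 2) (by positivity) (by linarith)
  have h2 := hbound k (by positivity) (by linarith)
  rw [Real.cos_sub_cos]
  have e1 : (θ + (k + 1 : ℕ) * θ) / 2 = (k + 2) * θ / 2 := by push_cast; ring
  have e2 : (θ - (k + 1 : ℕ) * θ) / 2 = -(k * θ / 2) := by push_cast; ring
  rw [e1, e2, Real.sin_neg]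
  calc _ = 2 * ((k + 2) / (n + 1) * (k / (n + 1)) : ℝ) := by push_cast; field_simp; ring
    _ ≤ 2 * (Real.sin ((k + 2) * θ / 2) * Real.sin (k * θ / 2)) := by
      have : (0 : ℝ) ≤ k / (n + 1) := by positivity
      have : (0 : ℝ) ≤ (k + 2) / (n + 1) := by positivity
      gcongr
      linarith
    _ = _ := by ring

theorem two_div_le_sin {n : ℕ} (i : Fin n) :
    2 / ((n : ℝ) + 1) ≤ Real.sin ((i + 1 : ℕ) * (Real.pi / (n + 1))) := by
  have hn : (0 : ℝ) < n + 1 := by positivity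
  have hi : ((i + 1 : ℕ) : ℝ) ≤ n := by exact_mod_cast i.2
  have hi1 : (1 : ℝ) ≤ ((i + 1 : ℕ) : ℝ) := by exact_mod_cast (by omega : 1 ≤ (i : ℕ) + 1)
  have key : ∀ s : ℝ, 1 ≤ s → s ≤ (n + 1) / 2 →
      2 / ((n : ℝ) + 1) ≤ Real.sin (s * (Real.pi / (n + 1))) := by
    intro s hs hsn
    have hle : s * (Real.pi / (n + 1)) ≤ Real.pi / 2 := by
      rw [← mul_div_assoc, div_le_iff₀ hn]
      nlinarith [Real.pi_pos]
    refine le_trans ?_ (Real.mul_le_sin (by positivity) hle)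
    have : 2 / Real.pi * (s * (Real.pi / (n + 1))) = 2 * s / (n + 1) := by field_simp
    rw [this]
    gcongr
    linarith
  by_cases h : ((i + 1 : ℕ) : ℝ) ≤ (n + 1) / 2
  · exact key _ hi1 h
  · rw [← Real.sin_pi_sub]
    have : Real.pi - (i + 1 : ℕ) * (Real.pi / (n + 1)) =
        ((n + 1) - (i + 1 : ℕ)) * (Real.pi / (n + 1)) := by field_simp
    rw [this]
    exact key _ (by linarith) (by linarith)

/-! ### The lazy walk and its spectrum. -/

/-- The transition operator of the lazy simple random walk on the grid, killed at the sink. -/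
noncomputable def gridWalk (n : ℕ) : Module.End ℝ (Fin n × Fin n → ℝ) where
  toFun f p := f p / 2 + (∑ q, ((gridSandpile n).mult (some p) (some q) : ℝ) * f q) / 8
  map_add' f g := by
    funext p
    simp only [Pi.add_apply, mul_add, Finset.sum_add_distrib]
    ring
  map_smul' r f := by
    funext p
    simp only [Pi.smul_apply, smul_eq_mul, RingHom.id_apply, mul_left_comm _ r, ← Finset.mul_sum]
    ring

theorem gridWalk_apply {n : ℕ} (f : Fin n × Fin n → ℝ) (p : Fin n × Fin n) :
    gridWalk n f p =
      f p / 2 + (∑ q, ((gridSandpile n).mult (some p) (some q) : ℝ) * f q) / 8 := rfl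

theorem gridWalk_pow_nonneg {n : ℕ} (m : ℕ) {f : Fin n × Fin n → ℝ} (hf : 0 ≤ f) :
    0 ≤ (gridWalk n ^ m) f := by
  induction m with
  | zero => simpa using hf
  | succ m ih =>
    intro p
    rw [pow_succ', Module.End.mul_apply, gridWalk_apply]
    have : 0 ≤ ∑ q, ((gridSandpile n).mult (some p) (some q) : ℝ) * (gridWalk n ^ m) f q :=
      Finset.sum_nonneg fun q _ => mul_nonneg (Nat.cast_nonneg _) (ih q)
    have := ih p
    simp only [Pi.zero_apply] at this ⊢
    positivity

theorem sum_gridWalk_pow_le {n : ℕ} (hn : 2 ≤ n) (m : ℕ) {f : Fin n × Fin n → ℝ} (hf : 0 ≤ f) :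
    ∑ p, (gridWalk n ^ m) f p ≤ ∑ p, f p := by
  induction m with
  | zero => simp
  | succ m ih =>
    refine le_trans ?_ ih
    have hnn := gridWalk_pow_nonneg m hf
    rw [pow_succ', Module.End.mul_apply]
    set h := (gridWalk n ^ m) f
    simp only [gridWalk_apply]
    rw [Finset.sum_add_distrib, ← Finset.sum_div, ← Finset.sum_div, Finset.sum_comm]
    have : ∑ q, ∑ p, ((gridSandpile n).mult (some p) (some q) : ℝ) * h q ≤ ∑ q, 4 * h q := by
      refine Finset.sum_le_sum fun q _ => ?_
      rw [← Finset.sum_mul]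
      refine mul_le_mul_of_nonneg_right ?_ (hnn q)
      have := (gridSandpile n).sum_mult_le_degree q
      rw [gridSandpile_degree hn] at this
      exact_mod_cast this
    rw [← Finset.mul_sum] at this
    linarith

/-- Eigenfunctions of the grid walk. -/
noncomputable def gridSin (n j k : ℕ) (p : Fin n × Fin n) : ℝ :=
  Real.sin ((j + 1 : ℕ) * ((p.1 + 1 : ℕ) * (Real.pi / (n + 1)))) *
    Real.sin ((k + 1 : ℕ) * ((p.2 + 1 : ℕ) * (Real.pi / (n + 1))))

/-- Eigenvalues of the grid walk. -/
noncomputable def gridEigenvalue (n j k : ℕ) : ℝ :=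
  1 / 2 + (Real.cos ((j + 1 : ℕ) * (Real.pi / (n + 1))) +
    Real.cos ((k + 1 : ℕ) * (Real.pi / (n + 1)))) / 4

theorem gridWalk_gridSin (n j k : ℕ) :
    gridWalk n (gridSin n j k) = gridEigenvalue n j k • gridSin n j k := by
  funext p
  obtain ⟨x, y⟩ := p
  set θ : ℝ := Real.pi / (n + 1) with hθ
  have hθN : ((n + 1 : ℕ) : ℝ) * θ = Real.pi := by rw [hθ]; push_cast; field_simp
  have hwall : ∀ j : ℕ, Real.sin ((j + 1 : ℕ) * ((n + 1 : ℕ) * θ)) = 0 := by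
    intro j
    rw [hθN]
    exact Real.sin_nat_mul_pi _
  have h := sum_gridMult (x, y) (F := fun a b : ℕ =>
    Real.sin ((j + 1 : ℕ) * (a * θ)) * Real.sin ((k + 1 : ℕ) * (b * θ)))
    (by simp) (fun b => by simp only [hwall, zero_mul]) (by simp)
    (fun a => by simp only [hwall, mul_zero])
  have hsum : ∀ (j a : ℕ), Real.sin ((j + 1 : ℕ) * (a * θ)) + Real.sin ((j + 1 : ℕ) * ((a + 2 : ℕ) * θ)) =
      2 * Real.cos ((j + 1 : ℕ) * θ) * Real.sin ((j + 1 : ℕ) * ((a + 1 : ℕ) * θ)) := by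
    intro j a
    have e1 : ((j + 1 : ℕ) : ℝ) * (a * θ) =
      (j + 1 : ℕ) * ((a + 1 : ℕ) * θ) - (j + 1 : ℕ) * θ := by push_cast; ring
    have e2 : ((j + 1 : ℕ) : ℝ) * ((a + 2 : ℕ) * θ) =
      (j + 1 : ℕ) * ((a + 1 : ℕ) * θ) + (j + 1 : ℕ) * θ := by push_cast; ring
    rw [e1, e2, Real.sin_sub, Real.sin_add]
    ring
  rw [gridWalk_apply]
  simp only [gridSin, gridEigenvalue, Pi.smul_apply, smul_eq_mul] at h ⊢
  rw [h, ← add_mul, ← mul_add, hsum, hsum]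
  ring

theorem gridWalk_pow_gridSin (n j k m : ℕ) :
    (gridWalk n ^ m) (gridSin n j k) = gridEigenvalue n j k ^ m • gridSin n j k := by
  induction m with
  | zero => simp
  | succ m ih =>
    rw [pow_succ', Module.End.mul_apply, ih, map_smul, gridWalk_gridSin, smul_smul, pow_succ]

theorem single_eq_sum_gridSin {n : ℕ} (v : Fin n × Fin n) :
    (Pi.single v 1 : Fin n × Fin n → ℝ) =
      ∑ j ∈ Finset.range n, ∑ k ∈ Finset.range n,
        ((2 / ((n : ℝ) + 1)) ^ 2 * gridSin n j k v) • gridSin n j k := by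
  funext p
  obtain ⟨x, y⟩ := p
  obtain ⟨a, b⟩ := v
  have hn : (n : ℝ) + 1 ≠ 0 := by positivity
  have hprod : ∑ j ∈ Finset.range n, ∑ k ∈ Finset.range n,
      ((2 / ((n : ℝ) + 1)) ^ 2 * gridSin n j k (a, b)) * gridSin n j k (x, y) =
      (2 / ((n : ℝ) + 1)) ^ 2 * ((if x = a then ((n : ℝ) + 1) / 2 else 0) *
        (if y = b then ((n : ℝ) + 1) / 2 else 0)) := by
    rw [← sum_sin_mul_sin a x, ← sum_sin_mul_sin b y, Finset.sum_mul_sum, Finset.mul_sum]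
    refine Finset.sum_congr rfl fun j _ => ?_
    rw [Finset.mul_sum]
    refine Finset.sum_congr rfl fun k _ => ?_
    simp only [gridSin]
    ring
  simp only [Finset.sum_apply, Pi.smul_apply, smul_eq_mul]
  rw [hprod, Pi.single_apply]
  by_cases hx : x = a <;> by_cases hy : y = b <;> simp [hx, hy]
  field_simp

theorem gridWalk_pow_single {n : ℕ} (v p : Fin n × Fin n) (m : ℕ) :
    (gridWalk n ^ m) (Pi.single v 1) p = (2 / ((n : ℝ) + 1)) ^ 2 *
      ∑ j ∈ Finset.range n, ∑ k ∈ Finset.range n,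
        gridEigenvalue n j k ^ m * (gridSin n j k v * gridSin n j k p) := by
  rw [single_eq_sum_gridSin]
  simp only [map_sum, map_smul, gridWalk_pow_gridSin, Finset.sum_apply, Pi.smul_apply, smul_eq_mul,
    Finset.mul_sum]
  exact Finset.sum_congr rfl fun j _ => Finset.sum_congr rfl fun k _ => by ring

/-- This is the purpose of laziness: on the bipartite grid the non-lazy spectrum is symmetric about
0, and the most negative eigenvalue would not decay relative to the top one. -/
theorem gridEigenvalue_nonneg (n j k : ℕ) : 0 ≤ gridEigenvalue n j k := by
  have h1 := Real.neg_one_le_cos ((j + 1 : ℕ) * (Real.pi / (n + 1)))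
  have h2 := Real.neg_one_le_cos ((k + 1 : ℕ) * (Real.pi / (n + 1)))
  rw [gridEigenvalue]
  linarith

theorem gridEigenvalue_le {n j k : ℕ} (hj : j < n) (hk : k < n) :
    gridEigenvalue n j k ≤
      gridEigenvalue n 0 0 * Real.exp (-(3 * (j + k)) / (2 * (n + 1) ^ 2)) := by
  have hj' := cos_sub_cos_nat_mul_ge hj
  have hk' := cos_sub_cos_nat_mul_ge hk
  have hN : (0 : ℝ) < (n + 1) ^ 2 := by positivity
  have hsq : ∀ i : ℕ, 3 * (i : ℝ) ≤ ((i + 1 : ℕ) : ℝ) ^ 2 - 1 := by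
    intro i
    have : i ≤ i ^ 2 := Nat.le_self_pow two_ne_zero i
    have : (i : ℝ) ≤ (i : ℝ) ^ 2 := by exact_mod_cast this
    push_cast
    nlinarith
  have hj'' : 2 * (3 * (j : ℝ)) / (n + 1) ^ 2 ≤ 2 * (((j + 1 : ℕ) : ℝ) ^ 2 - 1) / (n + 1) ^ 2 := by
    gcongr; exact hsq j
  have hk'' : 2 * (3 * (k : ℝ)) / (n + 1) ^ 2 ≤ 2 * (((k + 1 : ℕ) : ℝ) ^ 2 - 1) / (n + 1) ^ 2 := by
    gcongr; exact hsq k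
  have hexp := Real.add_one_le_exp (-(3 * ((j : ℝ) + k)) / (2 * (n + 1) ^ 2))
  have h0 := gridEigenvalue_nonneg n 0 0
  have h1 : gridEigenvalue n 0 0 ≤ 1 := by
    have := Real.cos_le_one (Real.pi / (n + 1))
    simp [gridEigenvalue]
    linarith
  set s : ℝ := 3 * ((j : ℝ) + k) / (2 * (n + 1) ^ 2) with hs
  have hs0 : 0 ≤ s := by positivity
  have hneg : -(3 * ((j : ℝ) + k)) / (2 * (n + 1) ^ 2) = -s := by rw [hs, neg_div]
  have hsplit : 2 * (3 * (j : ℝ)) / (n + 1) ^ 2 + 2 * (3 * (k : ℝ)) / (n + 1) ^ 2 = 4 * s := by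
    rw [hs]; field_simp; ring
  rw [hneg] at hexp ⊢
  calc gridEigenvalue n j k ≤ gridEigenvalue n 0 0 - s := by
        simp only [gridEigenvalue, zero_add, Nat.cast_one, one_mul]
        linarith
    -- Uses that the top eigenvalue is at most 1.
    _ ≤ gridEigenvalue n 0 0 * (-s + 1) := by nlinarith
    _ ≤ _ := mul_le_mul_of_nonneg_left hexp h0

theorem gridEigenvalue_pow_le {n j k m : ℕ} (hj : j < n) (hk : k < n)
    (hm : 4 * (n + 1) ^ 2 ≤ m) :
    gridEigenvalue n j k ^ m ≤ gridEigenvalue n 0 0 ^ m * ((1 / 64) ^ j * (1 / 64) ^ k) := by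
  have h0 := gridEigenvalue_nonneg n 0 0
  refine (pow_le_pow_left₀ (gridEigenvalue_nonneg n j k) (gridEigenvalue_le hj hk) m).trans ?_
  rw [mul_pow]
  refine mul_le_mul_of_nonneg_left ?_ (pow_nonneg h0 m)
  -- With `m ≥ 4(n+1)²` the exponent `3(j+k)m / (2(n+1)²)` is at least `6(j+k)`.
  have he : Real.exp (-6) ≤ 1 / 64 := by
    have : Real.exp (-6) = (Real.exp 1 ^ 6)⁻¹ := by
      rw [← Real.exp_nat_mul, ← Real.exp_neg]; norm_num
    rw [this, one_div]
    refine inv_anti₀ (by norm_num) ?_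
    calc (64 : ℝ) = 2 ^ 6 := by norm_num
      _ ≤ _ := pow_le_pow_left₀ (by norm_num) (by linarith [Real.add_one_le_exp 1]) 6
  rw [← pow_add]
  refine le_trans ?_ (pow_le_pow_left₀ (Real.exp_pos _).le he (j + k))
  rw [← Real.exp_nat_mul, ← Real.exp_nat_mul, Real.exp_le_exp]
  have hm' : (4 : ℝ) * (n + 1) ^ 2 ≤ m := by exact_mod_cast hm
  have hN : (0 : ℝ) < 2 * (n + 1) ^ 2 := by positivity
  have hjk : (0 : ℝ) ≤ (j : ℝ) + k := by positivity
  rw [← mul_div_assoc, div_le_iff₀ hN]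
  push_cast
  nlinarith

/-- Comparing the modes pointwise, not by a uniform bound, keeps the domination valid near the
boundary, where the principal mode is small. -/
theorem abs_gridSin_le {n : ℕ} (j k : ℕ) (p : Fin n × Fin n) :
    |gridSin n j k p| ≤ ((j + 1 : ℕ) : ℝ) * (k + 1 : ℕ) * gridSin n 0 0 p := by
  have hpos : ∀ i : Fin n, 0 ≤ Real.sin ((i + 1 : ℕ) * (Real.pi / (n + 1))) := fun i =>
    le_trans (by positivity) (two_div_le_sin i)
  have h1 := Real.abs_sin_nat_mul_le_mul (j + 1) ((p.1 + 1 : ℕ) * (Real.pi / (n + 1)))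
  have h2 := Real.abs_sin_nat_mul_le_mul (k + 1) ((p.2 + 1 : ℕ) * (Real.pi / (n + 1)))
  rw [abs_of_nonneg (hpos _)] at h1 h2
  simp only [gridSin, zero_add, Nat.cast_one, one_mul, abs_mul]
  calc _ ≤ _ := mul_le_mul h1 h2 (abs_nonneg _) (mul_nonneg (Nat.cast_nonneg _) (hpos _))
    _ = _ := by ring

theorem gridSin_zero_ge {n : ℕ} (p : Fin n × Fin n) :
    (2 / ((n : ℝ) + 1)) ^ 2 ≤ gridSin n 0 0 p := by
  simp only [gridSin, zero_add, Nat.cast_one, one_mul, sq]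
  exact mul_le_mul (two_div_le_sin _) (two_div_le_sin _) (by positivity)
    (le_trans (by positivity) (two_div_le_sin _))

/-! ### Lower bounds for the heat kernel and the Green function. -/

theorem sum_one_sixteenth_pow_le (n : ℕ) : ∑ j ∈ Finset.range n, (1 / 16 : ℝ) ^ j ≤ 16 / 15 := by
  rw [geom_sum_eq (by norm_num)]
  have : (0 : ℝ) ≤ (1 / 16) ^ n := by positivity
  rw [div_le_iff_of_neg (by norm_num)]
  linarith

/-- For times of order at least `n²` the principal eigenfunction dominates. -/
theorem gridWalk_pow_single_ge {n m : ℕ} (hn : 1 ≤ n) (hm : 4 * (n + 1) ^ 2 ≤ m)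
    (v p : Fin n × Fin n) :
    (2 / ((n : ℝ) + 1)) ^ 2 *
        (gridEigenvalue n 0 0 ^ m * (gridSin n 0 0 v * gridSin n 0 0 p) / 2) ≤
      (gridWalk n ^ m) (Pi.single v 1) p := by
  rw [gridWalk_pow_single]
  refine mul_le_mul_of_nonneg_left ?_ (by positivity)
  have hv : 0 ≤ gridSin n 0 0 v := le_trans (by positivity) (gridSin_zero_ge v)
  have hp : 0 ≤ gridSin n 0 0 p := le_trans (by positivity) (gridSin_zero_ge p)
  have hE : 0 ≤ gridEigenvalue n 0 0 ^ m := pow_nonneg (gridEigenvalue_nonneg _ _ _) m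
  set A := gridEigenvalue n 0 0 ^ m * (gridSin n 0 0 v * gridSin n 0 0 p) with hA
  have hA0 : 0 ≤ A := by positivity
  have hweight : ∀ i : ℕ, ((i + 1 : ℕ) : ℝ) ^ 2 * (1 / 64) ^ i ≤ (1 / 16) ^ i := by
    intro i
    have h1 : i + 1 ≤ 2 ^ i := Nat.lt_two_pow_self
    have h2 : ((i + 1 : ℕ) : ℝ) ≤ 2 ^ i := by exact_mod_cast h1
    calc ((i + 1 : ℕ) : ℝ) ^ 2 * (1 / 64) ^ i ≤ (2 ^ i) ^ 2 * (1 / 64) ^ i := by gcongr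
      _ = (1 / 16) ^ i := by rw [← pow_mul, mul_comm i 2, pow_mul, ← mul_pow]; norm_num
  -- The principal term `A` is written `2A - A`, so that the error `A / 16^(j+k)` can be summed over
  -- all modes.
  have hterm : ∀ j ∈ Finset.range n, ∀ k ∈ Finset.range n,
      (if j = 0 then (if k = 0 then 2 * A else 0) else 0) - A * ((1 / 16) ^ j * (1 / 16) ^ k) ≤
        gridEigenvalue n j k ^ m * (gridSin n j k v * gridSin n j k p) := by
    intro j hj k hk
    have habs : |gridEigenvalue n j k ^ m * (gridSin n j k v * gridSin n j k p)| ≤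
        A * ((1 / 16) ^ j * (1 / 16) ^ k) := by
      rw [abs_mul, abs_mul, abs_of_nonneg (pow_nonneg (gridEigenvalue_nonneg n j k) m)]
      calc _ ≤ gridEigenvalue n 0 0 ^ m * ((1 / 64) ^ j * (1 / 64) ^ k) *
            ((((j + 1 : ℕ) : ℝ) * (k + 1 : ℕ) * gridSin n 0 0 v) *
              (((j + 1 : ℕ) : ℝ) * (k + 1 : ℕ) * gridSin n 0 0 p)) := by
            gcongr
            · exact gridEigenvalue_pow_le (Finset.mem_range.mp hj) (Finset.mem_range.mp hk) hm
            · exact abs_gridSin_le j k v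
            · exact abs_gridSin_le j k p
        _ = A * ((((j + 1 : ℕ) : ℝ) ^ 2 * (1 / 64) ^ j) *
              (((k + 1 : ℕ) : ℝ) ^ 2 * (1 / 64) ^ k)) := by rw [hA]; ring
        _ ≤ _ := by gcongr <;> exact hweight _
    have hneg := neg_le_of_abs_le habs
    by_cases hj0 : j = 0
    · by_cases hk0 : k = 0
      · subst hj0 hk0
        simp only [if_true, pow_zero]
        linarith
      · simp only [hj0, hk0, if_true, if_false] at hneg ⊢
        linarith
    · simp only [hj0, if_false]
      linarith
  refine le_trans ?_ (Finset.sum_le_sum fun j hj => Finset.sum_le_sum fun k hk => hterm j hj k hk)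
  have hmain : ∑ j ∈ Finset.range n, ∑ k ∈ Finset.range n,
      (if j = 0 then (if k = 0 then 2 * A else 0) else 0) = 2 * A := by
    rw [Finset.sum_eq_single 0]
    · simp only [if_true, Finset.sum_ite_eq', Finset.mem_range]
      rw [if_pos (by omega)]
    · intro j _ hj
      simp [hj]
    · simp; omega
  have hrest : ∑ j ∈ Finset.range n, ∑ k ∈ Finset.range n,
      A * ((1 / 16 : ℝ) ^ j * (1 / 16) ^ k) ≤ A * (16 / 15 * (16 / 15)) := by
    simp_rw [← Finset.mul_sum]
    rw [← Finset.sum_mul]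
    refine mul_le_mul_of_nonneg_left ?_ hA0
    exact mul_le_mul (sum_one_sixteenth_pow_le n) (sum_one_sixteenth_pow_le n)
      (Finset.sum_nonneg fun _ _ => by positivity) (by norm_num)
  -- What remains is `2 - (16/15)² ≥ 1/2`.
  simp_rw [Finset.sum_sub_distrib]
  rw [hmain]
  linarith

theorem exp_le_gridEigenvalue_pow {n m : ℕ} (hn : 2 ≤ n) (hm : m ≤ 5 * (n + 1) ^ 2) :
    Real.exp (-25) ≤ gridEigenvalue n 0 0 ^ m := by
  have hn' : (2 : ℝ) ≤ n := by exact_mod_cast hn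
  set y : ℝ := 1 / (n + 1) ^ 2 with hy
  have hy0 : 0 < y := by positivity
  have hy1 : y ≤ 1 / 5 := by
    rw [hy]
    gcongr
    nlinarith
  have hθ : (Real.pi / (n + 1)) ^ 2 ≤ 10 * y := by
    rw [div_pow, hy, mul_one_div]
    gcongr
    nlinarith [Real.pi_lt_d2, Real.pi_pos]
  have hcos := Real.one_sub_sq_div_two_le_cos (x := Real.pi / (n + 1))
  have hbase : Real.exp (-(5 * y)) ≤ gridEigenvalue n 0 0 := by
    -- From `cos θ ≥ 1 - θ²/2` and `θ² ≤ 10 y`; the passage to `exp (-(5 * y))` needs `y ≤ 1/5`,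
    -- hence `n ≥ 2`.
    have h1 : 1 - 5 / 2 * y ≤ gridEigenvalue n 0 0 := by
      simp only [gridEigenvalue, zero_add, Nat.cast_one, one_mul]
      linarith
    refine le_trans ?_ h1
    rw [Real.exp_neg]
    refine inv_le_of_inv_le₀ (by linarith) (le_trans ?_ (Real.add_one_le_exp (5 * y)))
    rw [inv_le_iff_one_le_mul₀ (by linarith)]
    nlinarith
  refine le_trans ?_ (pow_le_pow_left₀ (Real.exp_pos _).le hbase m)
  rw [← Real.exp_nat_mul, Real.exp_le_exp]
  have hm' : (m : ℝ) ≤ 5 * (n + 1) ^ 2 := by exact_mod_cast hm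
  have : (m : ℝ) * y ≤ 5 := by
    rw [hy, mul_one_div, div_le_iff₀ (by positivity)]
    exact hm'
  linarith

/-- Expected number of visits to each vertex by the lazy walk started at `v`, up to a time of
order `n²`. -/
noncomputable def gridGreen (n : ℕ) (v : Fin n × Fin n) : Fin n × Fin n → ℝ :=
  ∑ m ∈ Finset.range (5 * (n + 1) ^ 2), (gridWalk n ^ m) (Pi.single v 1)

theorem single_nonneg {V : Type*} [DecidableEq V] (v : V) : (0 : V → ℝ) ≤ Pi.single v 1 :=
  Pi.single_nonneg.mpr zero_le_one

theorem sum_gridGreen_le {n : ℕ} (hn : 2 ≤ n) (v : Fin n × Fin n) :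
    ∑ p, gridGreen n v p ≤ 5 * (n + 1) ^ 2 := by
  simp only [gridGreen, Finset.sum_apply]
  rw [Finset.sum_comm]
  calc _ ≤ ∑ _m ∈ Finset.range (5 * (n + 1) ^ 2), (1 : ℝ) := by
        refine Finset.sum_le_sum fun m _ => ?_
        refine (sum_gridWalk_pow_le hn m (single_nonneg v)).trans ?_
        simp
    _ = _ := by simp

/-- The sum telescopes: `(P - 1)` applied to it is `P^M δ_v - δ_v`, which is nonnegative off `v`.
Truncation thus preserves subharmonicity. -/
theorem gridGreen_subharmonic {n : ℕ} (hn : 2 ≤ n) {v u : Fin n × Fin n} (huv : u ≠ v) :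
    (gridSandpile n).degree u * gridGreen n v u ≤
      ∑ q, ((gridSandpile n).mult (some u) (some q) : ℝ) * gridGreen n v q := by
  have htel : gridWalk n (gridGreen n v) - gridGreen n v =
      (gridWalk n ^ (5 * (n + 1) ^ 2)) (Pi.single v 1) - Pi.single v 1 := by
    rw [gridGreen, map_sum, ← Finset.sum_sub_distrib]
    simp_rw [← Module.End.mul_apply, ← pow_succ']
    rw [Finset.sum_range_sub (fun m => (gridWalk n ^ m) (Pi.single v 1))]
    simp
  have h := congrFun htel u
  have hnn := gridWalk_pow_nonneg (5 * (n + 1) ^ 2) (single_nonneg v) u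
  simp only [Pi.sub_apply, gridWalk_apply, Pi.single_eq_of_ne huv, Pi.zero_apply] at h hnn
  rw [gridSandpile_degree hn]
  push_cast
  linarith

theorem gridGreen_ge {n : ℕ} (hn : 2 ≤ n) (v p : Fin n × Fin n) :
    Real.exp (-25) / (n + 1) ^ 4 ≤ gridGreen n v p := by
  have hN : (0 : ℝ) < n + 1 := by positivity
  -- Only the last `(n+1)²` times are used. The power 6 collects `(n+1)²` from normalization and
  -- `(n+1)²` from the principal mode at each of `v` and `p`.
  have hterm : ∀ m ∈ Finset.Ico (4 * (n + 1) ^ 2) (5 * (n + 1) ^ 2),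
      Real.exp (-25) / (n + 1) ^ 6 ≤ (gridWalk n ^ m) (Pi.single v 1) p := by
    intro m hm
    rw [Finset.mem_Ico] at hm
    refine le_trans ?_ (gridWalk_pow_single_ge (by omega) hm.1 v p)
    calc Real.exp (-25) / (n + 1) ^ 6 ≤ (2 / ((n : ℝ) + 1)) ^ 2 *
          (Real.exp (-25) * ((2 / ((n : ℝ) + 1)) ^ 2 * (2 / ((n : ℝ) + 1)) ^ 2) / 2) := by
          have : (2 / ((n : ℝ) + 1)) ^ 2 *
              (Real.exp (-25) * ((2 / ((n : ℝ) + 1)) ^ 2 * (2 / ((n : ℝ) + 1)) ^ 2) / 2) =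
              32 * (Real.exp (-25) / (n + 1) ^ 6) := by field_simp; norm_num
          rw [this]
          have : 0 ≤ Real.exp (-25) / ((n : ℝ) + 1) ^ 6 := by positivity
          linarith
      _ ≤ _ := by
          have h1 := exp_le_gridEigenvalue_pow hn hm.2.le
          have h2 := gridSin_zero_ge v
          have h3 := gridSin_zero_ge p
          have h4 : 0 ≤ gridSin n 0 0 v := le_trans (by positivity) h2
          have h5 := pow_nonneg (gridEigenvalue_nonneg n 0 0) m
          gcongr
  have hcard : 5 * (n + 1) ^ 2 - 4 * (n + 1) ^ 2 = (n + 1) ^ 2 := by omega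
  calc Real.exp (-25) / (n + 1) ^ 4
      = ∑ _m ∈ Finset.Ico (4 * (n + 1) ^ 2) (5 * (n + 1) ^ 2), Real.exp (-25) / (n + 1) ^ 6 := by
        rw [Finset.sum_const, Nat.card_Ico, hcard, nsmul_eq_mul]
        push_cast
        field_simp
    _ ≤ ∑ m ∈ Finset.Ico (4 * (n + 1) ^ 2) (5 * (n + 1) ^ 2), (gridWalk n ^ m) (Pi.single v 1) p :=
        Finset.sum_le_sum hterm
    _ ≤ ∑ m ∈ Finset.range (5 * (n + 1) ^ 2), (gridWalk n ^ m) (Pi.single v 1) p := by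
        refine Finset.sum_le_sum_of_subset_of_nonneg (fun m hm => ?_) fun m _ _ =>
          gridWalk_pow_nonneg m (single_nonneg v) p
        simp only [Finset.mem_Ico, Finset.mem_range] at hm ⊢
        exact hm.2
    _ = gridGreen n v p := by simp [gridGreen]

/-! ### Conclusion. -/

theorem transientRun_gridSandpile_le {n t : ℕ} (hn : 2 ≤ n) {c : Fin n × Fin n → ℕ}
    (h : (gridSandpile n).TransientRun t c) : (t : ℝ) ≤ 1280 * Real.exp 25 * n ^ 6 := by
  obtain ⟨E, hE⟩ := gridSandpile_exists_superharmonic hn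
  have hB : ∀ v, ∑ u, ((gridSandpile n).degree u : ℝ) * gridGreen n v u ≤ 20 * (n + 1) ^ 2 := by
    intro v
    simp only [gridSandpile_degree hn, ← Finset.mul_sum]
    have := sum_gridGreen_le hn v
    push_cast
    linarith
  have hmul := h.mul_le hE (by positivity) (gridGreen_ge hn)
    (fun v u huv => gridGreen_subharmonic hn huv) hB
  have hN : (0 : ℝ) < n + 1 := by positivity
  rw [Real.exp_neg, ← mul_div_assoc, div_le_iff₀ (by positivity), ← div_eq_mul_inv,
    div_le_iff₀ (Real.exp_pos _)] at hmul
  have hn1 : (n : ℝ) + 1 ≤ 2 * n := by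
    have : (2 : ℝ) ≤ n := by exact_mod_cast hn
    linarith
  calc (t : ℝ) ≤ 20 * Real.exp 25 * (n + 1) ^ 6 := by
        refine hmul.trans (le_of_eq ?_)
        ring
    _ ≤ 20 * Real.exp 25 * (2 * n) ^ 6 := by gcongr
    _ = _ := by ring

/-- With a single vertex there is nothing off `v`, so the constant weight 1 serves. -/
theorem transientRun_gridSandpile_one_le {t : ℕ} {c : Fin 1 × Fin 1 → ℕ}
    (h : (gridSandpile 1).TransientRun t c) : t ≤ 2 := by
  have hdeg : ∀ u, (gridSandpile 1).degree u = 2 := by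
    intro u
    rw [Sandpile.degree, Fintype.sum_option, Fintype.sum_subsingleton _ u,
      (gridSandpile 1).mult_self]
    simp [gridSandpile, gridMult, gridSinkEdges]
  have := h.mul_le (E := fun _ => 1) (ε := 1) (B := 2) (g := fun _ _ => 1)
    (fun u => by
      rw [Fintype.sum_subsingleton _ u, (gridSandpile 1).mult_self, hdeg]
      norm_num)
    zero_le_one (fun _ _ => le_rfl) (fun v u huv => absurd (Subsingleton.elim u v) huv)
    (fun v => by simp [hdeg])
  rw [mul_one] at this
  exact_mod_cast this

theorem mainTheorem1 :
    ∃ C : ℕ, ∀ n : ℕ, 1 ≤ n → (gridSandpile n).tcl ≤ ((C * n ^ 7 : ℕ) : ℕ∞) := by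
  -- The summand 2 covers `n = 1`; the other covers `n ≥ 2`, where `n ^ 6` is weakened to `n ^ 7`.
  refine ⟨2 + ⌈1280 * Real.exp 25⌉₊, fun n hn => iSup₂_le fun t ht => ?_⟩
  obtain ⟨c, hc⟩ := ht
  rw [Nat.cast_le]
  obtain rfl | hn2 := hn.eq_or_lt
  · have := transientRun_gridSandpile_one_le hc
    omega
  · have h1 := transientRun_gridSandpile_le hn2 hc
    have h2 : (t : ℝ) ≤ ((⌈1280 * Real.exp 25⌉₊ * n ^ 6 : ℕ) : ℝ) := by
      push_cast
      exact h1.trans (by gcongr; exact Nat.le_ceil _)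
    have h3 : t ≤ ⌈1280 * Real.exp 25⌉₊ * n ^ 6 := by exact_mod_cast h2
    exact h3.trans (Nat.mul_le_mul (by omega) (Nat.pow_le_pow_right hn (by norm_num)))
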